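/- Conventions. Let $(P,\rho)$ be a finite weakly ranked poset, that is, a finite poset with nonnegative integers $\rho_{st}$ for $s\le t$ such that $\rho_{st}>0$ for $s<t$ and $\rho_{st}=\rho_{sw}+\rho_{wt}$ for $s\le w\le t$. In the incidence algebra of $P$ over $\mathbb{Z}[x]$, put $(a^{\mathrm{rev}})_{st}(x)=x^{\rho_{st}}a_{st}(x^{-1})$ when $\deg a_{st}\le\rho_{st}$, and $(a^{\mathrm{sgn}})_{st}=(-1)^{\rho_{st}}a_{st}$. A kernel is an element $\kappa$ with $\deg\kappa_{st}\le\rho_{st}$, $\kappa_{ss}=1$ and $\kappa^{-1}=\kappa^{\mathrm{rev}}$. Its Chow function is $H=-\overline{\kappa}^{\,-1}$, where $\overline\kappa_{ss}=-1$ and $\overline\kappa_{st}=\kappa_{st}/(x-1)$ for $s<t$; its right Kazhdan–Lusztig–Stanley function is the unique $f$ with $f_{ss}=1$, $\deg f_{st}<\tfrac12\rho_{st}$ for $s<t$, and $\kappa=f^{\mathrm{rev}}f^{-1}$; its right augmented Chow function is $F=H f^{\mathrm{rev}}$. Let $\chi=\mu\,\zeta^{\mathrm{rev}}$ be the characteristic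 kernel, where $\zeta$ is the zeta function and $\mu=\zeta^{-1}$ the Möbius function. Denote by $H^*$ and $F^*$ the Chow function and the right augmented Chow function of the kernel $(\chi^{\mathrm{rev}})^{\mathrm{sgn}}$. For a matroid $\mathsf{N}$ on a finite ground set, with lattice of flats $\mathcal{L}(\mathsf{N})$ and $\rho_{FG}=\operatorname{rk}G-\operatorname{rk}F$, write $H^*_{\mathsf{N}}(x)$ and $F^*_{\mathsf{N}}(x)$ for the values of $H^*$ and $F^*$ on the interval $[\widehat{0},\widehat{1}]$ of $\mathcal{L}(\mathsf{N})$. Theorem. Let $\mathsf{M}$ be a matroid on a finite ground set $E$, and let $i\in E$ be an element that is neither a loop nor a coloop and is not parallel to any other element. Let $\underline{\mathscr{S}}_i$ be the set of flats $F\neq\widehat{0}$ of $\mathsf{M}$ such that $i\notin F$ and $F\cup\{i\}$ is a flat of $\mathsf{M}$. Then $$H^*_{\mathsf{M}}(x)=H^*_{\mathsf{M}\setminus i}(x)+(x+1)\,H^*_{\mathsf{M}/i}(x)+x\sum_{F\in\underline{\mathscr{S}}_i}H^*_{\mathsf{M}|F}(x)\,H^*_{\mathsf{M}/(F\cup\{i\})}(x)$$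 and $$F^*_{\mathsf{M}}(x)=F^*_{\mathsf{M}\setminus i}(x)+(x+1)\,F^*_{\mathsf{M}/i}(x)+x\sum_{F\in\underline{\mathscr{S}}_i}H^*_{\mathsf{M}|F}(x)\,F^*_{\mathsf{M}/(F\cup\{i\})}(x).$$ -/

import Mathlib

open Polynomial
open scoped Matroid

namespace DualChow

/-! ### Weakly ranked posets and their incidence algebras over `ℤ[X]` -/

/-- A weak rank function on a poset. Only the values `ρ s t` with `s ≤ t`, i.e. the values on
closed intervals, are meaningful. -/
structure WeakRank (P : Type*) [PartialOrder P] where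
  /-- the value on the interval from `s` to `t` -/
  rank : P → P → ℕ
  rank_pos : ∀ s t, s < t → 0 < rank s t
  rank_add : ∀ s w t, s ≤ w → w ≤ t → rank s t = rank s w + rank w t

section Poset

variable {P : Type*} [PartialOrder P]

/-- Membership in the subalgebra `I_ρ(P)`: the entry at `s ≤ t` has degree at most `ρ s t`. -/
def DegreeBounded (ρ : WeakRank P) (a : IncidenceAlgebra ℤ[X] P) : Prop :=
  ∀ s t, s ≤ t → (a s t).natDegree ≤ ρ.rank s t

/-- The reversal `(a^rev) s t = x ^ (ρ s t) * (a s t)(x⁻¹)`; the operation is the intended one on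
elements satisfying `DegreeBounded`. -/
noncomputable def rev (ρ : WeakRank P) (a : IncidenceAlgebra ℤ[X] P) :
    IncidenceAlgebra ℤ[X] P where
  toFun s t := (a s t).reflect (ρ.rank s t)
  eq_zero_of_not_le' s t h := by
    rw [IncidenceAlgebra.apply_eq_zero_of_not_le h, reflect_zero]

/-- The sign twist `(a^sgn) s t = (-1) ^ (ρ s t) * a s t`. -/
noncomputable def sgn (ρ : WeakRank P) (a : IncidenceAlgebra ℤ[X] P) :
    IncidenceAlgebra ℤ[X] P where
  toFun s t := (-1) ^ ρ.rank s t * a s t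
  eq_zero_of_not_le' s t h := by
    rw [IncidenceAlgebra.apply_eq_zero_of_not_le h, mul_zero]

variable [DecidableEq P]

/-- The element `κ̄`: equal to `-1` on the diagonal and to `κ s t / (x - 1)` for `s < t`
(an exact division when `κ` is a kernel). -/
noncomputable def kernelBar (κ : IncidenceAlgebra ℤ[X] P) : IncidenceAlgebra ℤ[X] P where
  toFun s t := if s = t then -1 else κ s t /ₘ (X - C 1)
  eq_zero_of_not_le' s t h := by
    rw [if_neg (fun e => h e.le), IncidenceAlgebra.apply_eq_zero_of_not_le h, zero_divByMonic]

variable [LocallyFiniteOrder P]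

/-- `κ` is a `(P, ρ)`-kernel: `κ ∈ I_ρ(P)`, `κ s s = 1`, and `κ^rev` is the two-sided inverse of
`κ`. -/
structure IsKernel (ρ : WeakRank P) (κ : IncidenceAlgebra ℤ[X] P) : Prop where
  degreeBounded : DegreeBounded ρ κ
  diag : ∀ s, κ s s = 1
  mul_rev : κ * rev ρ κ = 1
  rev_mul : rev ρ κ * κ = 1

/-- The Chow function `H = -(κ̄)⁻¹` of `κ`. Since `κ̄` is `-1` on the diagonal, it is a unit of the
incidence algebra, and `Ring.inverse` is its two-sided inverse. -/
noncomputable def chow (κ : IncidenceAlgebra ℤ[X] P) : IncidenceAlgebra ℤ[X] P :=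
  -Ring.inverse (kernelBar κ)

/-- `f` is a right Kazhdan–Lusztig–Stanley function of `κ`: `f ∈ I_ρ(P)`, `f s s = 1`,
`deg (f s t) < ρ s t / 2` for `s < t`, and `κ = f^rev * f⁻¹`. -/
structure IsRightKLS (ρ : WeakRank P) (κ f : IncidenceAlgebra ℤ[X] P) : Prop where
  degreeBounded : DegreeBounded ρ f
  diag : ∀ s, f s s = 1
  degree_lt : ∀ s t, s < t → 2 * (f s t).natDegree < ρ.rank s t
  isUnit : IsUnit f
  eq_mul : κ = rev ρ f * Ring.inverse f

open Classical in
/-- The right Kazhdan–Lusztig–Stanley function of `κ`, which exists and is unique for every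
kernel `κ` (it is set to `0` if there is none). -/
noncomputable def rightKLS (ρ : WeakRank P) (κ : IncidenceAlgebra ℤ[X] P) :
    IncidenceAlgebra ℤ[X] P :=
  if h : ∃ f, IsRightKLS ρ κ f then h.choose else 0

/-- The right augmented Chow function `F = H * f^rev` of `κ`. -/
noncomputable def rightAugChow (ρ : WeakRank P) (κ : IncidenceAlgebra ℤ[X] P) :
    IncidenceAlgebra ℤ[X] P :=
  chow κ * rev ρ (rightKLS ρ κ)

/-- The sign-twisted reverse kernel `(κ^rev)^sgn`. -/
noncomputable def dualKernel (ρ : WeakRank P) (κ : IncidenceAlgebra ℤ[X] P) :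
    IncidenceAlgebra ℤ[X] P :=
  sgn ρ (rev ρ κ)

/-- The dual Chow function `H*` of `κ`. -/
noncomputable def dualChow (ρ : WeakRank P) (κ : IncidenceAlgebra ℤ[X] P) :
    IncidenceAlgebra ℤ[X] P :=
  chow (dualKernel ρ κ)

/-- The dual right augmented Chow function `F*` of `κ`. -/
noncomputable def dualRightAugChow (ρ : WeakRank P) (κ : IncidenceAlgebra ℤ[X] P) :
    IncidenceAlgebra ℤ[X] P :=
  rightAugChow ρ (dualKernel ρ κ)

/-- The characteristic function `χ = μ * ζ^rev` of `(P, ρ)`. -/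
noncomputable def charKernel [DecidableLE P] (ρ : WeakRank P) : IncidenceAlgebra ℤ[X] P :=
  IncidenceAlgebra.mu ℤ[X] * rev ρ (IncidenceAlgebra.zeta ℤ[X])

end Poset

/-! ### The lattice of flats of a finite matroid -/

section Matroid

variable {α : Type*}

/-- The lattice of flats `L(M)`, ordered by inclusion. -/
abbrev Flat (M : Matroid α) : Type _ := {F : Set α // M.IsFlat F}

noncomputable instance instDecidableEqFlat (M : Matroid α) : DecidableEq (Flat M) :=
  Classical.decEq _

noncomputable instance instDecidableLEFlat (M : Matroid α) : DecidableLE (Flat M) :=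
  Classical.decRel _

instance instBoundedOrderFlat (M : Matroid α) : BoundedOrder (Flat M) where
  top := ⟨M.E, M.ground_isFlat⟩
  le_top F := F.2.subset_ground
  bot := ⟨M.closure ∅, M.isFlat_closure ∅⟩
  bot_le F := (M.closure_subset_closure (Set.empty_subset F.1)).trans F.2.closure.le

instance instFiniteFlat (M : Matroid α) [M.Finite] : Finite (Flat M) :=
  (M.ground_finite.finite_subsets.subset fun _ hF => hF.subset_ground).to_subtype

noncomputable instance instFintypeFlat (M : Matroid α) [M.Finite] : Fintype (Flat M) :=
  Fintype.ofFinite _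

open Classical in
noncomputable instance instLocallyFiniteOrderFlat (M : Matroid α) [M.Finite] :
    LocallyFiniteOrder (Flat M) :=
  Fintype.toLocallyFiniteOrder

instance instFiniteRestrictFlat (M : Matroid α) [M.Finite] (F : Flat M) : (M ↾ F.1).Finite :=
  Matroid.restrict_finite (M.ground_finite.subset F.2.subset_ground)

/-- The rank function of the matroid, with values in `ℕ`. -/
noncomputable def rk (M : Matroid α) (A : Set α) : ℕ := (M.eRk A).toNat

theorem rk_mono (M : Matroid α) [M.Finite] {A B : Set α} (h : A ⊆ B) : rk M A ≤ rk M B :=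
  ENat.toNat_le_toNat (M.eRk_mono h) (M.isRkFinite_set B).eRk_lt_top.ne

theorem rk_lt_of_lt (M : Matroid α) [M.Finite] {F G : Flat M} (h : F < G) :
    rk M F.1 < rk M G.1 := by
  refine lt_of_le_of_ne (rk_mono M h.le) fun e => h.ne (Subtype.ext ?_)
  have e' : M.eRk F.1 = M.eRk G.1 := by
    rw [← ENat.natCast_toNat (M.isRkFinite_set F.1).eRk_lt_top.ne,
      ← ENat.natCast_toNat (M.isRkFinite_set G.1).eRk_lt_top.ne]
    exact congrArg _ e
  have := (M.isRkFinite_set F.1).closure_eq_closure_of_subset_of_eRk_ge_eRk h.le e'.ge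
  rwa [F.2.closure, G.2.closure] at this

/-- The rank function on intervals of the lattice of flats: `ρ F G = rk G - rk F`. -/
noncomputable def flatRank (M : Matroid α) [M.Finite] : WeakRank (Flat M) where
  rank F G := rk M G.1 - rk M F.1
  rank_pos _ _ h := Nat.sub_pos_of_lt (rk_lt_of_lt M h)
  rank_add F K G h₁ h₂ := by
    have := rk_mono M (show F.1 ⊆ K.1 from h₁)
    have := rk_mono M (show K.1 ⊆ G.1 from h₂)
    omega

/-- The dual Chow polynomial `H*_M` of a matroid: the dual Chow polynomial of its lattice of flats
with respect to the characteristic kernel. -/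
noncomputable def dualChowPoly (M : Matroid α) [M.Finite] : ℤ[X] :=
  dualChow (flatRank M) (charKernel (flatRank M)) ⊥ ⊤

/-- The dual right augmented Chow polynomial `F*_M` of a matroid. -/
noncomputable def dualRightAugChowPoly (M : Matroid α) [M.Finite] : ℤ[X] :=
  dualRightAugChow (flatRank M) (charKernel (flatRank M)) ⊥ ⊤

open Classical in
/-- The family of flats `F` with `i ∉ F` such that `F ∪ {i}` is a flat. -/
noncomputable def flatsExtendableBy (M : Matroid α) [M.Finite] (i : α) : Finset (Flat M) :=
  Finset.univ.filter fun F => i ∉ F.1 ∧ M.IsFlat (F.1 ∪ {i})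

/-- Two distinct elements are parallel if they form a two-element circuit. -/
def Parallel (M : Matroid α) (i j : α) : Prop := i ≠ j ∧ M.IsCircuit {i, j}

end Matroid

end DualChow

/-!
The dual kernel of the characteristic kernel `χ = μ * ζ^rev` factors as
`κ = (μ^rev)^sgn * ζ^sgn`. So its right Kazhdan–Lusztig–Stanley function is `μ^sgn`, whose entries
are constants, and `κ` is the unique solution of `ζ_{-X} * κ = ζ_{-1}`, where `ζ_q` denotes the
weighted zeta function `q ^ ρ` (`powZeta`). The dual Chow function `H` satisfies
`(X - κ) * H = X - 1`, and the dual right augmented Chow function is `H * ζ_{-X}⁻¹`. All of these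
depend only on intervals, so `H` and `F` of `M ↾ F` and `M ／ C` are entries of the functions of `M`
(`IsConvexEmbedding.pullback_dualChow`).

The lattice of flats of `M` consists of the closures `σ K` of the flats `K` of `M ＼ {i}` and of the
flats `τ F = F ∪ {i}` with `F` extendable by `i`. For a function `h` on `L(M)`, let `D_q h` be the
function on `L(M ＼ {i})` with `D_q h K = h (σ K) - q * h (τ K)`, the second term being present only
for extendable `K`. Splitting the sum over the flats above `σ K` according to the two kinds gives
`ζ'_q (D_{-q} h) = (ζ_q h) ∘ σ` (`IsDeletion.act_powZeta_deletionMap`), where primes refer to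
`M ＼ {i}`. Taking `q = -1` and `q = -X` yields `κ' D_1 = D_X κ`
(`IsDeletion.act_dualKernel_deletionMap`). Applying `D_X` to `(X - κ) h = (X - 1) u`, where
`h = H u`, and cancelling `X - 1`, one finds
`D_1 h = H' (D_X u) + X * H' (h ∘ τ)` (`IsDeletion.act_dualChow`). At the least flat, which is
extendable because `i` is neither a loop nor parallel to another element, this is the theorem: the
first formula for `u` the indicator function of the top flat, the second for `u` the last column of
`ζ_{-X}⁻¹`.
-/

namespace DualChow

/-! ### Incidence algebras of weakly ranked posets -/

section Poset

variable {P : Type*} [PartialOrder P]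

theorem WeakRank.rank_self (ρ : WeakRank P) (s : P) : ρ.rank s s = 0 := by
  have := ρ.rank_add s s s le_rfl le_rfl
  omega

theorem WeakRank.rank_lt (ρ : WeakRank P) {s w t : P} (h₁ : s < w) (h₂ : w ≤ t) :
    ρ.rank w t < ρ.rank s t := by
  have := ρ.rank_add s w t h₁.le h₂
  have := ρ.rank_pos s w h₁
  omega

theorem WeakRank.rank_lt' (ρ : WeakRank P) {s w t : P} (h₁ : s ≤ w) (h₂ : w < t) :
    ρ.rank s w < ρ.rank s t := by
  have := ρ.rank_add s w t h₁ h₂.le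
  have := ρ.rank_pos w t h₂
  omega

/-- The weighted zeta function `s, t ↦ q ^ (ρ s t)`. -/
noncomputable def powZeta [DecidableLE P] (ρ : WeakRank P) (q : ℤ[X]) :
    IncidenceAlgebra ℤ[X] P where
  toFun s t := if s ≤ t then q ^ ρ.rank s t else 0
  eq_zero_of_not_le' _ _ h := if_neg h

theorem powZeta_apply [DecidableLE P] (ρ : WeakRank P) (q : ℤ[X]) (s t : P) :
    powZeta ρ q s t = if s ≤ t then q ^ ρ.rank s t else 0 := rfl

theorem rev_apply (ρ : WeakRank P) (a : IncidenceAlgebra ℤ[X] P) (s t : P) :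
    rev ρ a s t = (a s t).reflect (ρ.rank s t) := rfl

theorem sgn_apply (ρ : WeakRank P) (a : IncidenceAlgebra ℤ[X] P) (s t : P) :
    sgn ρ a s t = (-1) ^ ρ.rank s t * a s t := rfl

theorem sgn_zeta [DecidableLE P] (ρ : WeakRank P) :
    sgn ρ (IncidenceAlgebra.zeta ℤ[X]) = powZeta ρ (-1) := by
  ext s t h : 1
  simp [sgn_apply, powZeta_apply, h]

theorem sgn_rev_zeta [DecidableLE P] (ρ : WeakRank P) :
    sgn ρ (rev ρ (IncidenceAlgebra.zeta ℤ[X])) = powZeta ρ (-X) := by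
  ext s t h : 1
  simp [sgn_apply, rev_apply, powZeta_apply, h, neg_pow (X : ℤ[X])]

theorem rev_rev (ρ : WeakRank P) (a : IncidenceAlgebra ℤ[X] P) : rev ρ (rev ρ a) = a := by
  ext s t h : 1
  simp [rev_apply]

theorem rev_sgn (ρ : WeakRank P) (a : IncidenceAlgebra ℤ[X] P) :
    rev ρ (sgn ρ a) = sgn ρ (rev ρ a) := by
  ext s t h : 1
  simp only [rev_apply, sgn_apply]
  rcases neg_one_pow_eq_or ℤ[X] (ρ.rank s t) with e | e <;> simp [e, reflect_neg]

theorem eval_one_reflect (n : ℕ) (p : ℤ[X]) (h : p.natDegree ≤ n) :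
    (p.reflect n).eval 1 = p.eval 1 := by
  let _ : Invertible (1 : ℤ) := invertibleOne
  have := eval₂_reflect_mul_pow (RingHom.id ℤ) 1 n p h
  simpa [eval₂_id] using this

theorem degreeBounded_zeta [DecidableLE P] (ρ : WeakRank P) :
    DegreeBounded ρ (IncidenceAlgebra.zeta ℤ[X]) := by
  intro s t h
  simp [h]

theorem degreeBounded_rev (ρ : WeakRank P) {a : IncidenceAlgebra ℤ[X] P}
    (ha : DegreeBounded ρ a) : DegreeBounded ρ (rev ρ a) := fun s t h =>
  natDegree_reflect_le.trans (max_le le_rfl (ha s t h))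

section Mul

variable [LocallyFiniteOrder P]

theorem sgn_mul (ρ : WeakRank P) (a b : IncidenceAlgebra ℤ[X] P) :
    sgn ρ (a * b) = sgn ρ a * sgn ρ b := by
  ext s t h : 1
  simp only [sgn_apply, IncidenceAlgebra.mul_apply, Finset.mul_sum]
  refine Finset.sum_congr rfl fun w hw => ?_
  rw [Finset.mem_Icc] at hw
  rw [ρ.rank_add s w t hw.1 hw.2, pow_add]
  ring

theorem rev_mul (ρ : WeakRank P) {a b : IncidenceAlgebra ℤ[X] P} (ha : DegreeBounded ρ a)
    (hb : DegreeBounded ρ b) : rev ρ (a * b) = rev ρ a * rev ρ b := by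
  ext s t h : 1
  simp only [rev_apply, IncidenceAlgebra.mul_apply]
  have key : ∀ (T : Finset P) (g : P → ℤ[X]) (n : ℕ),
      (∑ w ∈ T, g w).reflect n = ∑ w ∈ T, (g w).reflect n := fun T g n =>
    map_sum (AddMonoidHom.mk' (reflect n) fun f g => reflect_add f g n) g T
  rw [key]
  refine Finset.sum_congr rfl fun w hw => ?_
  rw [Finset.mem_Icc] at hw
  rw [ρ.rank_add s w t hw.1 hw.2, reflect_mul _ _ (ha _ _ hw.1) (hb _ _ hw.2)]

end Mul

variable [DecidableEq P]

theorem sgn_one (ρ : WeakRank P) : sgn ρ 1 = 1 := by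
  ext s t h : 1
  by_cases e : s = t
  · subst e
    simp [sgn_apply, ρ.rank_self]
  · simp [sgn_apply, e]

theorem rev_one (ρ : WeakRank P) : rev ρ 1 = 1 := by
  ext s t h : 1
  by_cases e : s = t
  · subst e
    simp [rev_apply, ρ.rank_self]
  · simp [rev_apply, e]

variable [LocallyFiniteOrder P]

theorem natDegree_mu (ρ : WeakRank P) (s t : P) :
    (IncidenceAlgebra.mu ℤ[X] s t).natDegree = 0 := by
  induction h : ρ.rank s t using Nat.strong_induction_on generalizing t with
  | _ n ih =>
    subst h
    rw [IncidenceAlgebra.mu_apply]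
    split_ifs with e
    · simp
    · rw [natDegree_neg, ← Nat.le_zero]
      refine natDegree_sum_le_of_forall_le _ _ fun x hx => ?_
      rw [Finset.mem_Ico] at hx
      exact (ih _ (ρ.rank_lt' hx.1 hx.2) x rfl).le

theorem degreeBounded_mu (ρ : WeakRank P) : DegreeBounded ρ (IncidenceAlgebra.mu ℤ[X]) :=
  fun s t _ => (natDegree_mu ρ s t).le.trans (Nat.zero_le _)

section DecidableLE

variable [DecidableLE P]

theorem powZeta_mul_sgn_rev_mu (ρ : WeakRank P) :
    powZeta ρ (-X) * sgn ρ (rev ρ (IncidenceAlgebra.mu ℤ[X])) = 1 := by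
  rw [← sgn_rev_zeta, ← sgn_mul, ← rev_mul ρ (degreeBounded_zeta ρ) (degreeBounded_mu ρ),
    IncidenceAlgebra.zeta_mul_mu, rev_one, sgn_one]

theorem sgn_rev_mu_mul_powZeta (ρ : WeakRank P) :
    sgn ρ (rev ρ (IncidenceAlgebra.mu ℤ[X])) * powZeta ρ (-X) = 1 := by
  rw [← sgn_rev_zeta, ← sgn_mul, ← rev_mul ρ (degreeBounded_mu ρ) (degreeBounded_zeta ρ),
    IncidenceAlgebra.mu_mul_zeta, rev_one, sgn_one]

theorem powZeta_mul_left_cancel (ρ : WeakRank P) {a b : IncidenceAlgebra ℤ[X] P}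
    (h : powZeta ρ (-X) * a = powZeta ρ (-X) * b) : a = b := by
  rw [← one_mul a, ← one_mul b, ← sgn_rev_mu_mul_powZeta ρ, mul_assoc, h, mul_assoc]

/-- The factorization `κ = (μ^rev)^sgn * ζ^sgn` of the dual `κ` of the characteristic kernel. -/
theorem dualKernel_charKernel (ρ : WeakRank P) :
    dualKernel ρ (charKernel ρ) =
      sgn ρ (rev ρ (IncidenceAlgebra.mu ℤ[X])) * powZeta ρ (-1) := by
  rw [dualKernel, charKernel,
    rev_mul ρ (degreeBounded_mu ρ) (degreeBounded_rev ρ (degreeBounded_zeta ρ)), rev_rev, sgn_mul,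
    sgn_zeta]

/-- The form in which the dual kernel enters the rest of the argument: it is determined by two
weighted zeta functions. -/
theorem powZeta_mul_dualKernel (ρ : WeakRank P) :
    powZeta ρ (-X) * dualKernel ρ (charKernel ρ) = powZeta ρ (-1) := by
  rw [dualKernel_charKernel, ← mul_assoc, powZeta_mul_sgn_rev_mu, one_mul]

theorem dualKernel_self (ρ : WeakRank P) (s : P) : dualKernel ρ (charKernel ρ) s s = 1 := by
  rw [dualKernel_charKernel]
  simp [sgn_apply, rev_apply, powZeta_apply, ρ.rank_self]

/-- The characteristic polynomial of a nontrivial interval vanishes at `1`; so does its dual. -/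
theorem X_sub_one_dvd_dualKernel (ρ : WeakRank P) {s t : P} (h : s ≠ t) :
    X - C 1 ∣ dualKernel ρ (charKernel ρ) s t := by
  rw [dvd_iff_isRoot, IsRoot]
  have e : (charKernel ρ s t).eval 1 = 0 := by
    have := congrArg (fun a => (a s t).eval 1) (IncidenceAlgebra.mu_mul_zeta (𝕜 := ℤ[X]) (α := P))
    simp only [IncidenceAlgebra.one_apply, if_neg h, eval_zero] at this
    rw [← this, charKernel]
    simp only [IncidenceAlgebra.mul_apply, eval_finsetSum, eval_mul]
    refine Finset.sum_congr rfl fun w hw => ?_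
    rw [Finset.mem_Icc] at hw
    rw [rev_apply, eval_one_reflect _ _ (degreeBounded_zeta ρ _ _ hw.2)]
  by_cases hst : s ≤ t
  · have hd : (charKernel ρ s t).natDegree ≤ ρ.rank s t := by
      rw [charKernel, IncidenceAlgebra.mul_apply]
      refine natDegree_sum_le_of_forall_le _ _ fun w hw => ?_
      rw [Finset.mem_Icc] at hw
      refine natDegree_mul_le.trans ?_
      rw [ρ.rank_add s w t hw.1 hw.2]
      exact add_le_add (degreeBounded_mu ρ _ _ hw.1)
        (degreeBounded_rev ρ (degreeBounded_zeta ρ) _ _ hw.2)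
    rw [dualKernel, sgn_apply, rev_apply, eval_mul, eval_one_reflect _ _ hd, e, mul_zero]
  · rw [IncidenceAlgebra.apply_eq_zero_of_not_le hst, eval_zero]

theorem smul_kernelBar_dualKernel (ρ : WeakRank P) :
    (X - 1 : ℤ[X]) • kernelBar (dualKernel ρ (charKernel ρ)) + (X : ℤ[X]) • 1 =
      dualKernel ρ (charKernel ρ) := by
  ext s t h : 1
  simp only [IncidenceAlgebra.constSMul_apply, IncidenceAlgebra.add_apply,
    IncidenceAlgebra.one_apply, smul_eq_mul]
  change (X - 1 : ℤ[X]) * (if s = t then -1 else _ /ₘ (X - C 1)) + _ = _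
  split_ifs with e
  · subst e
    rw [dualKernel_self]
    ring
  · have := (modByMonic_eq_zero_iff_dvd (monic_X_sub_C 1)).2 (X_sub_one_dvd_dualKernel ρ e)
    have h2 := modByMonic_add_div (dualKernel ρ (charKernel ρ) s t) (X - C 1 : ℤ[X])
    rw [this, zero_add, C_1] at h2
    rw [C_1, h2]
    simp

end DecidableLE

/-- Uniqueness of the right Kazhdan–Lusztig–Stanley function, by induction on the rank of the
interval: a polynomial fixed by a reversal and of less than half its degree is zero. -/
theorem IsRightKLS.unique (ρ : WeakRank P) {κ f g : IncidenceAlgebra ℤ[X] P}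
    (hκ : ∀ s, κ s s = 1) (hf : IsRightKLS ρ κ f) (hg : IsRightKLS ρ κ g) : f = g := by
  have hrev : ∀ {f}, IsRightKLS ρ κ f → κ * f = rev ρ f := fun h => by
    rw [h.eq_mul, mul_assoc, Ring.inverse_mul_cancel _ h.isUnit, mul_one]
  ext s t hst : 1
  induction h : ρ.rank s t using Nat.strong_induction_on generalizing s with
  | _ n ih =>
    subst h
    rcases eq_or_lt_of_le hst with rfl | hlt
    · rw [hf.diag, hg.diag]
    -- By induction `f` and `g` agree on `[w, t]` for `s < w`, so in `κ * (f - g)` only the term at `s`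
    -- survives: the difference is fixed by reversal.
    have hd : (f s t - g s t).reflect (ρ.rank s t) = f s t - g s t := by
      rw [reflect_sub, ← rev_apply, ← rev_apply, ← hrev hf, ← hrev hg,
        IncidenceAlgebra.mul_apply, IncidenceAlgebra.mul_apply, ← Finset.sum_sub_distrib,
        Finset.sum_eq_single s]
      · rw [hκ, one_mul, one_mul]
      · intro w hw hws
        rw [Finset.mem_Icc] at hw
        rw [ih _ (ρ.rank_lt (lt_of_le_of_ne hw.1 hws.symm) hw.2) w hw.2 rfl, sub_self]
      · intro h
        exact absurd (Finset.left_mem_Icc.2 hst) h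
    have hdeg : 2 * (f s t - g s t).natDegree < ρ.rank s t := by
      have h1 := hf.degree_lt s t hlt
      have h2 := hg.degree_lt s t hlt
      have h3 := natDegree_sub_le (f s t) (g s t)
      omega
    rw [← sub_eq_zero]
    by_contra hne
    have hc := congrArg (fun p => p.coeff (f s t - g s t).natDegree) hd
    simp only [coeff_reflect] at hc
    rw [revAt_le (by omega), coeff_eq_zero_of_natDegree_lt (by omega)] at hc
    exact hne (leadingCoeff_eq_zero.1 hc.symm)

/-- The strictly upper triangular part `1 - a` is nilpotent, its powers being bounded by the rank. -/
theorem isUnit_of_diag_eq_one [Fintype P] (ρ : WeakRank P) {a : IncidenceAlgebra ℤ[X] P}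
    (ha : ∀ s, a s s = 1) : IsUnit a := by
  have key : ∀ k s t, ρ.rank s t < k → ((1 - a) ^ k) s t = 0 := by
    intro k
    induction k with
    | zero => intro s t h; omega
    | succ k ih =>
      intro s t h
      rw [pow_succ', IncidenceAlgebra.mul_apply]
      refine Finset.sum_eq_zero fun w hw => ?_
      rw [Finset.mem_Icc] at hw
      rcases eq_or_lt_of_le hw.1 with rfl | hlt
      · simp [IncidenceAlgebra.sub_apply, ha]
      · rw [ih w t (by have := ρ.rank_lt hlt hw.2; omega), mul_zero]
  have hn : IsNilpotent (1 - a) := by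
    refine ⟨(∑ s, ∑ t, ρ.rank s t) + 1, ?_⟩
    ext s t h : 1
    refine key _ s t (Nat.lt_succ_of_le ?_)
    exact (Finset.single_le_sum (f := fun t => ρ.rank s t) (fun _ _ => Nat.zero_le _)
      (Finset.mem_univ t)).trans (Finset.single_le_sum (f := fun s => ∑ t, ρ.rank s t)
      (fun _ _ => Nat.zero_le _) (Finset.mem_univ s))
  simpa using hn.isUnit_one_sub

theorem isUnit_kernelBar [Fintype P] (ρ : WeakRank P) (κ : IncidenceAlgebra ℤ[X] P) :
    IsUnit (kernelBar κ) := by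
  have : IsUnit (-kernelBar κ) := isUnit_of_diag_eq_one ρ fun s => by
    change -(if s = s then (-1 : ℤ[X]) else _) = 1
    simp
  simpa using this.neg

theorem kernelBar_mul_chow [Fintype P] (ρ : WeakRank P) (κ : IncidenceAlgebra ℤ[X] P) :
    kernelBar κ * chow κ + 1 = 0 := by
  ext s t h : 1
  have e := congrArg (fun a => a s t) (Ring.mul_inverse_cancel _ (isUnit_kernelBar ρ κ))
  have hc : ∀ w, chow κ w t = -Ring.inverse (kernelBar κ) w t := fun _ => rfl
  simp only [IncidenceAlgebra.mul_apply] at e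
  simp only [IncidenceAlgebra.add_apply, IncidenceAlgebra.mul_apply, hc, mul_neg,
    Finset.sum_neg_distrib, e, IncidenceAlgebra.zero_apply, neg_add_cancel]

theorem chow_mul_kernelBar [Fintype P] (ρ : WeakRank P) (κ : IncidenceAlgebra ℤ[X] P) :
    chow κ * kernelBar κ + 1 = 0 := by
  ext s t h : 1
  have e := congrArg (fun a => a s t) (Ring.inverse_mul_cancel _ (isUnit_kernelBar ρ κ))
  have hc : ∀ w, chow κ s w = -Ring.inverse (kernelBar κ) s w := fun _ => rfl
  simp only [IncidenceAlgebra.mul_apply] at e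
  simp only [IncidenceAlgebra.add_apply, IncidenceAlgebra.mul_apply, hc, neg_mul,
    Finset.sum_neg_distrib, e, IncidenceAlgebra.zero_apply, neg_add_cancel]

theorem chow_self [Fintype P] (ρ : WeakRank P) (κ : IncidenceAlgebra ℤ[X] P) (s : P) :
    chow κ s s = 1 := by
  have h := congrArg (fun a => a s s) (kernelBar_mul_chow ρ κ)
  have e : kernelBar κ s s = -1 := if_pos rfl
  simp only [IncidenceAlgebra.add_apply, IncidenceAlgebra.mul_apply, Finset.Icc_self,
    Finset.sum_singleton, e, IncidenceAlgebra.one_apply, if_true, IncidenceAlgebra.zero_apply] at h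
  linear_combination -h

section DecidableLE

variable [DecidableLE P] [Fintype P]

/-- With `smul_kernelBar_dualKernel`, the definition of the Chow function reads
`(X - κ) * H = X - 1`. -/
theorem dualKernel_mul_dualChow (ρ : WeakRank P) :
    dualKernel ρ (charKernel ρ) * dualChow ρ (charKernel ρ) + (X - 1 : ℤ[X]) • 1 =
      (X : ℤ[X]) • dualChow ρ (charKernel ρ) := by
  conv_lhs => rw [← smul_kernelBar_dualKernel ρ]
  rw [add_mul, smul_mul_assoc, smul_mul_assoc, one_mul]
  ext s t h : 1
  have e := congrArg (fun a => a s t) (kernelBar_mul_chow ρ (dualKernel ρ (charKernel ρ)))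
  simp only [IncidenceAlgebra.add_apply, IncidenceAlgebra.constSMul_apply, smul_eq_mul,
    IncidenceAlgebra.zero_apply, dualChow] at e ⊢
  linear_combination (X - 1) * e

theorem dualChow_mul_dualKernel (ρ : WeakRank P) :
    dualChow ρ (charKernel ρ) * dualKernel ρ (charKernel ρ) + (X - 1 : ℤ[X]) • 1 =
      (X : ℤ[X]) • dualChow ρ (charKernel ρ) := by
  conv_lhs => enter [1, 2]; rw [← smul_kernelBar_dualKernel ρ]
  rw [mul_add, mul_smul_comm, mul_smul_comm, mul_one]
  ext s t h : 1
  have e := congrArg (fun a => a s t) (chow_mul_kernelBar ρ (dualKernel ρ (charKernel ρ)))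
  simp only [IncidenceAlgebra.add_apply, IncidenceAlgebra.constSMul_apply, smul_eq_mul,
    IncidenceAlgebra.zero_apply, dualChow] at e ⊢
  linear_combination (X - 1) * e

/-- The right Kazhdan–Lusztig–Stanley function of the dual kernel consists of the constants
`(-1) ^ ρ * μ`, by the factorization `dualKernel_charKernel`. -/
theorem isRightKLS_sgn_mu (ρ : WeakRank P) :
    IsRightKLS ρ (dualKernel ρ (charKernel ρ)) (sgn ρ (IncidenceAlgebra.mu ℤ[X])) := by
  have hdeg : ∀ s t, (sgn ρ (IncidenceAlgebra.mu ℤ[X]) s t).natDegree = 0 := fun s t => by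
    rw [sgn_apply]
    rcases neg_one_pow_eq_or ℤ[X] (ρ.rank s t) with e | e <;> simp [e, natDegree_mu ρ]
  have hdiag : ∀ s, sgn ρ (IncidenceAlgebra.mu ℤ[X]) s s = 1 := fun s => by
    simp [sgn_apply, ρ.rank_self]
  refine ⟨fun s t _ => by simp [hdeg], hdiag, fun s t h => ?_, isUnit_of_diag_eq_one ρ hdiag, ?_⟩
  · simpa [hdeg] using ρ.rank_pos s t h
  · have hu := isUnit_of_diag_eq_one ρ hdiag
    rw [Ring.eq_mul_inverse_iff_mul_eq _ _ _ hu, dualKernel_charKernel, rev_sgn, mul_assoc,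
      ← sgn_zeta, ← sgn_mul, IncidenceAlgebra.zeta_mul_mu, sgn_one, mul_one]

theorem rightKLS_dualKernel (ρ : WeakRank P) :
    rightKLS ρ (dualKernel ρ (charKernel ρ)) = sgn ρ (IncidenceAlgebra.mu ℤ[X]) := by
  have h : ∃ f, IsRightKLS ρ (dualKernel ρ (charKernel ρ)) f := ⟨_, isRightKLS_sgn_mu ρ⟩
  rw [rightKLS, dif_pos h]
  exact h.choose_spec.unique ρ (dualKernel_self ρ) (isRightKLS_sgn_mu ρ)

theorem dualRightAugChow_charKernel (ρ : WeakRank P) :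
    dualRightAugChow ρ (charKernel ρ) =
      dualChow ρ (charKernel ρ) * sgn ρ (rev ρ (IncidenceAlgebra.mu ℤ[X])) := by
  rw [dualRightAugChow, rightAugChow, rightKLS_dualKernel, rev_sgn, dualChow]

end DecidableLE

end Poset

/-! ### Convex embeddings -/

section Pullback

variable {P Q : Type*} [PartialOrder P] [PartialOrder Q]

/-- An order embedding that preserves the weak rank and has a convex image, so that it identifies
each interval of `Q` with an interval of `P`. -/
structure IsConvexEmbedding (ρ' : WeakRank Q) (ρ : WeakRank P) (φ : Q ↪o P) : Prop where
  rank_eq : ∀ s t, s ≤ t → ρ.rank (φ s) (φ t) = ρ'.rank s t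
  convex : ∀ s t w, φ s ≤ w → w ≤ φ t → w ∈ Set.range φ

/-- The restriction of an element of the incidence algebra along an order embedding. -/
noncomputable def pullback (φ : Q ↪o P) (a : IncidenceAlgebra ℤ[X] P) : IncidenceAlgebra ℤ[X] Q where
  toFun s t := a (φ s) (φ t)
  eq_zero_of_not_le' _ _ h :=
    IncidenceAlgebra.apply_eq_zero_of_not_le (fun e => h (φ.le_iff_le.1 e)) a

theorem pullback_apply (φ : Q ↪o P) (a : IncidenceAlgebra ℤ[X] P) (s t : Q) :
    pullback φ a s t = a (φ s) (φ t) := rfl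

variable {ρ' : WeakRank Q} {ρ : WeakRank P} {φ : Q ↪o P}

theorem pullback_one [DecidableEq P] [DecidableEq Q] :
    pullback φ (1 : IncidenceAlgebra ℤ[X] P) = 1 := by
  ext s t h : 1
  simp [pullback_apply]

theorem pullback_kernelBar [DecidableEq P] [DecidableEq Q] (κ : IncidenceAlgebra ℤ[X] P) :
    kernelBar (pullback φ κ) = pullback φ (kernelBar κ) := by
  ext s t h : 1
  change (if s = t then (-1 : ℤ[X]) else _) = if φ s = φ t then -1 else _
  simp only [φ.injective.eq_iff]
  rfl

theorem IsConvexEmbedding.pullback_powZeta [DecidableLE P] [DecidableLE Q]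
    (hφ : IsConvexEmbedding ρ' ρ φ) (q : ℤ[X]) :
    pullback φ (powZeta ρ q) = powZeta ρ' q := by
  ext s t h : 1
  simp [pullback_apply, powZeta_apply, h, hφ.rank_eq s t h]

variable [LocallyFiniteOrder P] [LocallyFiniteOrder Q]

theorem IsConvexEmbedding.pullback_mul (hφ : IsConvexEmbedding ρ' ρ φ)
    (a b : IncidenceAlgebra ℤ[X] P) : pullback φ (a * b) = pullback φ a * pullback φ b := by
  ext s t h : 1
  simp only [pullback_apply, IncidenceAlgebra.mul_apply]
  symm
  refine Finset.sum_bij (fun w _ => φ w) ?_ ?_ ?_ ?_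
  · intro w hw
    simpa using hw
  · intro _ _ _ _ e
    exact φ.injective e
  · intro w hw
    rw [Finset.mem_Icc] at hw
    obtain ⟨w, rfl⟩ := hφ.convex s t w hw.1 hw.2
    exact ⟨w, by simpa using hw, rfl⟩
  · intro _ _
    rfl

variable [DecidableEq P] [DecidableEq Q] [DecidableLE P] [DecidableLE Q]

theorem IsConvexEmbedding.pullback_dualKernel (hφ : IsConvexEmbedding ρ' ρ φ) :
    pullback φ (dualKernel ρ (charKernel ρ)) = dualKernel ρ' (charKernel ρ') := by
  apply powZeta_mul_left_cancel ρ'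
  rw [powZeta_mul_dualKernel, ← hφ.pullback_powZeta, ← hφ.pullback_mul, powZeta_mul_dualKernel,
    hφ.pullback_powZeta]

theorem IsConvexEmbedding.pullback_sgn_rev_mu (hφ : IsConvexEmbedding ρ' ρ φ) :
    pullback φ (sgn ρ (rev ρ (IncidenceAlgebra.mu ℤ[X]))) =
      sgn ρ' (rev ρ' (IncidenceAlgebra.mu ℤ[X])) := by
  apply powZeta_mul_left_cancel ρ'
  rw [powZeta_mul_sgn_rev_mu, ← hφ.pullback_powZeta, ← hφ.pullback_mul, powZeta_mul_sgn_rev_mu,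
    pullback_one]

variable [Fintype P] [Fintype Q]

theorem IsConvexEmbedding.pullback_dualChow (hφ : IsConvexEmbedding ρ' ρ φ) :
    pullback φ (dualChow ρ (charKernel ρ)) = dualChow ρ' (charKernel ρ') := by
  rw [dualChow, dualChow, ← hφ.pullback_dualKernel]
  set κ := dualKernel ρ (charKernel ρ)
  refine (isUnit_kernelBar ρ' (pullback φ κ)).mul_left_cancel (add_right_cancel (b := 1) ?_)
  rw [kernelBar_mul_chow ρ', pullback_kernelBar, ← hφ.pullback_mul]
  have h := congrArg (pullback φ) (kernelBar_mul_chow ρ κ)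
  refine Eq.trans ?_ h
  rw [← pullback_one (φ := φ)]
  rfl

theorem IsConvexEmbedding.pullback_dualRightAugChow (hφ : IsConvexEmbedding ρ' ρ φ) :
    pullback φ (dualRightAugChow ρ (charKernel ρ)) = dualRightAugChow ρ' (charKernel ρ') := by
  rw [dualRightAugChow_charKernel, dualRightAugChow_charKernel, hφ.pullback_mul,
    hφ.pullback_dualChow, hφ.pullback_sgn_rev_mu]

end Pullback

/-! ### The action on functions -/

section Act

variable {P : Type*} [PartialOrder P] [Fintype P]

/-- The action of the incidence algebra of a finite poset on functions, seen as column vectors. -/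
noncomputable def act (a : IncidenceAlgebra ℤ[X] P) (h : P → ℤ[X]) : P → ℤ[X] :=
  fun s => ∑ t, a s t * h t

theorem act_smul (a : IncidenceAlgebra ℤ[X] P) (c : ℤ[X]) (h : P → ℤ[X]) :
    act a (c • h) = c • act a h := by
  funext s
  simp only [act, Pi.smul_apply, smul_eq_mul, Finset.mul_sum]
  exact Finset.sum_congr rfl fun _ _ => by ring

theorem act_add (a : IncidenceAlgebra ℤ[X] P) (h k : P → ℤ[X]) :
    act a (h + k) = act a h + act a k := by
  funext s
  simp only [act, Pi.add_apply, mul_add, Finset.sum_add_distrib]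

theorem add_act (a b : IncidenceAlgebra ℤ[X] P) (h : P → ℤ[X]) :
    act (a + b) h = act a h + act b h := by
  funext s
  simp only [act, Pi.add_apply, IncidenceAlgebra.add_apply, add_mul, Finset.sum_add_distrib]

theorem smul_act (c : ℤ[X]) (a : IncidenceAlgebra ℤ[X] P) (h : P → ℤ[X]) :
    act (c • a) h = c • act a h := by
  funext s
  simp only [act, Pi.smul_apply, smul_eq_mul, IncidenceAlgebra.constSMul_apply, Finset.mul_sum,
    mul_assoc]

theorem one_act [DecidableEq P] (h : P → ℤ[X]) : act 1 h = h := by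
  funext s
  simp [act]

variable [LocallyFiniteOrder P]

theorem mul_apply_eq_sum_univ (a b : IncidenceAlgebra ℤ[X] P) (s t : P) :
    (a * b) s t = ∑ w, a s w * b w t := by
  rw [IncidenceAlgebra.mul_apply]
  refine Finset.sum_subset (Finset.subset_univ _) fun w _ hw => ?_
  by_cases h : s ≤ w
  · rw [IncidenceAlgebra.apply_eq_zero_of_not_le (b := t) (a := w), mul_zero]
    exact fun h' => hw (Finset.mem_Icc.2 ⟨h, h'⟩)
  · rw [IncidenceAlgebra.apply_eq_zero_of_not_le h, zero_mul]

theorem mul_act (a b : IncidenceAlgebra ℤ[X] P) (h : P → ℤ[X]) :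
    act (a * b) h = act a (act b h) := by
  funext s
  simp only [act, mul_apply_eq_sum_univ, Finset.sum_mul, Finset.mul_sum]
  rw [Finset.sum_comm]
  exact Finset.sum_congr rfl fun _ _ => Finset.sum_congr rfl fun _ _ => by ring

variable [DecidableEq P] [DecidableLE P]

theorem act_powZeta_injective (ρ : WeakRank P) :
    Function.Injective (act (powZeta ρ (-X))) := fun h k e => by
  rw [← one_act h, ← one_act k, ← sgn_rev_mu_mul_powZeta ρ, mul_act, mul_act, e]

end Act

/-! ### The deletion recursion for functions on posets -/

section Transfer

variable {P Q S : Type*} [Fintype S] [DecidableEq Q] {σ : Q → P} {ι : S → Q} {τ : S → P}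

/-- The function `K ↦ h (τ K)` on the flats in the family `S`, extended by zero. -/
noncomputable def extensionMap (ι : S → Q) (τ : S → P) (h : P → ℤ[X]) : Q → ℤ[X] :=
  fun K => ∑ F, if ι F = K then h (τ F) else 0

/-- The transfer of functions `h ↦ h ∘ σ - q * extensionMap h` along a deletion. -/
noncomputable def deletionMap (σ : Q → P) (ι : S → Q) (τ : S → P) (q : ℤ[X]) (h : P → ℤ[X]) :
    Q → ℤ[X] :=
  h ∘ σ - q • extensionMap ι τ h

theorem extensionMap_smul_sub (c : ℤ[X]) (d : ℤ[X]) (h k : P → ℤ[X]) :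
    extensionMap ι τ (c • h - d • k) = c • extensionMap ι τ h - d • extensionMap ι τ k := by
  funext K
  simp only [extensionMap, Pi.sub_apply, Pi.smul_apply, smul_eq_mul, Finset.mul_sum,
    ← Finset.sum_sub_distrib]
  exact Finset.sum_congr rfl fun F _ => by split_ifs <;> simp

theorem deletionMap_smul_sub (q c d : ℤ[X]) (h k : P → ℤ[X]) :
    deletionMap σ ι τ q (c • h - d • k) =
      c • deletionMap σ ι τ q h - d • deletionMap σ ι τ q k := by
  rw [deletionMap, deletionMap, deletionMap, extensionMap_smul_sub]
  funext K
  simp only [Pi.sub_apply, Function.comp_apply, Pi.smul_apply, smul_eq_mul]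
  ring

theorem act_extensionMap [PartialOrder Q] [Fintype Q] (a : IncidenceAlgebra ℤ[X] Q)
    (h : P → ℤ[X]) (K : Q) :
    act a (extensionMap ι τ h) K = ∑ F, a K (ι F) * h (τ F) := by
  simp only [act, extensionMap, Finset.mul_sum]
  rw [Finset.sum_comm]
  refine Finset.sum_congr rfl fun F _ => ?_
  simp

end Transfer

section Deletion

variable {P Q S : Type*} [PartialOrder P] [PartialOrder Q]

/-- The relation between the lattice of flats `P` of a matroid and the lattice of flats `Q` of a
single-element deletion: `σ` is the closure map, `S` indexes the flats `ι F` of the deletion for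
which both `ι F` and `τ F`, obtained by adding the deleted element, are flats of the matroid. -/
structure IsDeletion (ρ : WeakRank P) (ρ' : WeakRank Q) (σ : Q → P) (ι : S → Q) (τ : S → P) :
    Prop where
  bijective : Function.Bijective (Sum.elim σ τ)
  le_iff : ∀ K G, σ K ≤ σ G ↔ K ≤ G
  rank_eq : ∀ K G, K ≤ G → ρ.rank (σ K) (σ G) = ρ'.rank K G
  le_iff' : ∀ K F, σ K ≤ τ F ↔ K ≤ ι F
  rank_eq' : ∀ K F, K ≤ ι F → ρ.rank (σ K) (τ F) = ρ'.rank K (ι F) + 1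

variable {ρ : WeakRank P} {ρ' : WeakRank Q} {σ : Q → P} {ι : S → Q} {τ : S → P}
variable [Fintype S] [Fintype P] [Fintype Q] [DecidableEq Q] [DecidableLE P] [DecidableLE Q]

/-- Splitting the sum over the flats above `σ K` according to the two kinds of flats of `P`. -/
theorem IsDeletion.act_powZeta_deletionMap (H : IsDeletion ρ ρ' σ ι τ) (q : ℤ[X])
    (h : P → ℤ[X]) :
    act (powZeta ρ' q) (deletionMap σ ι τ (-q) h) = act (powZeta ρ q) h ∘ σ := by
  funext K
  have e : deletionMap σ ι τ (-q) h = h ∘ σ + q • extensionMap ι τ h := by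
    rw [deletionMap, neg_smul, sub_neg_eq_add]
  rw [e, act_add, act_smul, Pi.add_apply, Pi.smul_apply, act_extensionMap, Function.comp_apply]
  simp only [act]
  rw [← (Equiv.ofBijective _ H.bijective).sum_comp, Fintype.sum_sum_type, smul_eq_mul,
    Finset.mul_sum]
  congr 1
  · refine Finset.sum_congr rfl fun G _ => ?_
    simp only [Equiv.ofBijective_apply, Sum.elim_inl, powZeta_apply, H.le_iff,
      Function.comp_apply]
    split_ifs with hKG
    · rw [H.rank_eq K G hKG]
    · rfl
  · refine Finset.sum_congr rfl fun F _ => ?_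
    simp only [Equiv.ofBijective_apply, Sum.elim_inr, powZeta_apply, H.le_iff']
    split_ifs with hKF
    · rw [H.rank_eq' K F hKF, pow_succ]
      ring
    · simp

variable [LocallyFiniteOrder P] [LocallyFiniteOrder Q] [DecidableEq P]

/-- The dual kernels are intertwined by the transfers with weights `1` and `X`. -/
theorem IsDeletion.act_dualKernel_deletionMap (H : IsDeletion ρ ρ' σ ι τ) (h : P → ℤ[X]) :
    act (dualKernel ρ' (charKernel ρ')) (deletionMap σ ι τ 1 h) =
      deletionMap σ ι τ X (act (dualKernel ρ (charKernel ρ)) h) := by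
  apply act_powZeta_injective ρ'
  have h₁ := H.act_powZeta_deletionMap (-1) h
  have h₂ := H.act_powZeta_deletionMap (-X) (act (dualKernel ρ (charKernel ρ)) h)
  rw [neg_neg] at h₁ h₂
  rw [← mul_act, powZeta_mul_dualKernel, h₁, h₂, ← mul_act, powZeta_mul_dualKernel]

/-- The intertwining relation for the inverse of `powZeta (-X)`, the second factor of the dual
augmented Chow function. -/
theorem IsDeletion.deletionMap_act_sgn_rev_mu (H : IsDeletion ρ ρ' σ ι τ) (h : P → ℤ[X]) :
    deletionMap σ ι τ X (act (sgn ρ (rev ρ (IncidenceAlgebra.mu ℤ[X]))) h) =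
      act (sgn ρ' (rev ρ' (IncidenceAlgebra.mu ℤ[X]))) (h ∘ σ) := by
  apply act_powZeta_injective ρ'
  have h₂ := H.act_powZeta_deletionMap (-X) (act (sgn ρ (rev ρ (IncidenceAlgebra.mu ℤ[X]))) h)
  rw [neg_neg] at h₂
  rw [h₂, ← mul_act, ← mul_act, powZeta_mul_sgn_rev_mu, powZeta_mul_sgn_rev_mu, one_act, one_act]

/-- The deletion recursion for `H u`, where `H` is the dual Chow function: applying the transfer
with weight `X` to `(X - κ) (H u) = (X - 1) u` yields an equation that `H'` inverts. -/
theorem IsDeletion.act_dualChow (H : IsDeletion ρ ρ' σ ι τ) (u : P → ℤ[X]) :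
    deletionMap σ ι τ 1 (act (dualChow ρ (charKernel ρ)) u) =
      act (dualChow ρ' (charKernel ρ')) (deletionMap σ ι τ X u) +
        (X : ℤ[X]) • act (dualChow ρ' (charKernel ρ'))
          (extensionMap ι τ (act (dualChow ρ (charKernel ρ)) u)) := by
  set h := act (dualChow ρ (charKernel ρ)) u with hh
  set g := deletionMap σ ι τ 1 h with hg
  set κ' := dualKernel ρ' (charKernel ρ')
  set H' := dualChow ρ' (charKernel ρ') with hH'
  have hκ : act (dualKernel ρ (charKernel ρ)) h = (X : ℤ[X]) • h - (X - 1 : ℤ[X]) • u := by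
    have e := congrArg (fun a => act a u) (dualKernel_mul_dualChow ρ)
    simp only [add_act, smul_act, mul_act, one_act] at e
    exact eq_sub_of_add_eq e
  have hκg : act κ' g + (X - 1 : ℤ[X]) • (deletionMap σ ι τ X u +
      (X : ℤ[X]) • extensionMap ι τ h) = (X : ℤ[X]) • g := by
    rw [hg, H.act_dualKernel_deletionMap, hκ, deletionMap_smul_sub]
    funext K
    simp only [deletionMap, Pi.sub_apply, Pi.add_apply, Pi.smul_apply, smul_eq_mul,
      Function.comp_apply]
    ring
  have hmul := congrArg (act H') hκg
  rw [act_add, act_smul, act_smul, act_add, act_smul, ← mul_act] at hmul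
  have e := congrArg (fun a => act a g) (dualChow_mul_dualKernel ρ')
  simp only [add_act, smul_act, one_act] at e
  funext K
  have e₁ := congrFun hmul K
  have e₂ := congrFun e K
  simp only [Pi.add_apply, Pi.smul_apply, smul_eq_mul] at e₁ e₂ ⊢
  refine mul_left_cancel₀ (X_sub_C_ne_zero (1 : ℤ)) ?_
  rw [C_1]
  linear_combination e₂ - e₁

/-- The deletion recursion for the columns of the dual Chow function indexed by `t = σ t'`, for
`t` outside the image of `τ`. -/
theorem IsDeletion.dualChow_apply (H : IsDeletion ρ ρ' σ ι τ) (K t : Q) :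
    dualChow ρ (charKernel ρ) (σ K) (σ t) =
      dualChow ρ' (charKernel ρ') K t +
        extensionMap ι τ (fun G => dualChow ρ (charKernel ρ) G (σ t)) K +
        X * ∑ F, dualChow ρ' (charKernel ρ') K (ι F) * dualChow ρ (charKernel ρ) (τ F) (σ t) := by
  have hu : deletionMap σ ι τ X (Pi.single (σ t) 1) = Pi.single t 1 := by
    have hσ : ∀ G, σ G = σ t ↔ G = t := fun G => by
      refine ⟨fun e => le_antisymm ((H.le_iff _ _).1 e.le) ((H.le_iff _ _).1 e.ge), ?_⟩
      rintro rfl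
      rfl
    have hτ : ∀ F, τ F ≠ σ t := fun F e => by
      have := H.bijective.1 (a₁ := Sum.inr F) (a₂ := Sum.inl t) e
      cases this
    funext G
    simp [deletionMap, extensionMap, Pi.single_apply, hσ, hτ]
  have e := congrFun (H.act_dualChow (Pi.single (σ t) 1)) K
  have hs : ∀ G, act (dualChow ρ (charKernel ρ)) (Pi.single (σ t) 1) G =
      dualChow ρ (charKernel ρ) G (σ t) := fun G => by
    simp [act, Pi.single_apply]
  have hs' : act (dualChow ρ' (charKernel ρ')) (Pi.single t 1) K =
      dualChow ρ' (charKernel ρ') K t := by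
    simp [act, Pi.single_apply]
  rw [hu, Pi.add_apply, Pi.smul_apply, act_extensionMap, hs', deletionMap, Pi.sub_apply,
    Function.comp_apply, one_smul, hs, smul_eq_mul, funext hs] at e
  linear_combination e

/-- The deletion recursion for the columns of the dual right augmented Chow function. These are
`H u` for a column `u` of `(μ^rev)^sgn`, which the transfer with weight `X` sends to the
corresponding column for the deletion. -/
theorem IsDeletion.dualRightAugChow_apply (H : IsDeletion ρ ρ' σ ι τ) (K t : Q) :
    dualRightAugChow ρ (charKernel ρ) (σ K) (σ t) =
      dualRightAugChow ρ' (charKernel ρ') K t +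
        extensionMap ι τ (fun G => dualRightAugChow ρ (charKernel ρ) G (σ t)) K +
        X * ∑ F, dualChow ρ' (charKernel ρ') K (ι F) *
          dualRightAugChow ρ (charKernel ρ) (τ F) (σ t) := by
  have hσ : (Pi.single (σ t) 1 : P → ℤ[X]) ∘ σ = Pi.single t 1 := by
    have hσ : ∀ G, σ G = σ t ↔ G = t := fun G => by
      refine ⟨fun e => le_antisymm ((H.le_iff _ _).1 e.le) ((H.le_iff _ _).1 e.ge), ?_⟩
      rintro rfl
      rfl
    funext G
    simp [Pi.single_apply, hσ]
  have e := congrFun (H.act_dualChow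
    (act (sgn ρ (rev ρ (IncidenceAlgebra.mu ℤ[X]))) (Pi.single (σ t) 1))) K
  rw [H.deletionMap_act_sgn_rev_mu, hσ, ← mul_act, ← mul_act, ← dualRightAugChow_charKernel,
    ← dualRightAugChow_charKernel] at e
  have hs : ∀ G, act (dualRightAugChow ρ (charKernel ρ)) (Pi.single (σ t) 1) G =
      dualRightAugChow ρ (charKernel ρ) G (σ t) := fun G => by
    simp [act, Pi.single_apply]
  have hs' : act (dualRightAugChow ρ' (charKernel ρ')) (Pi.single t 1) K =
      dualRightAugChow ρ' (charKernel ρ') K t := by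
    simp [act, Pi.single_apply]
  rw [Pi.add_apply, Pi.smul_apply, act_extensionMap, hs', deletionMap, Pi.sub_apply,
    Function.comp_apply, one_smul, hs, smul_eq_mul, funext hs] at e
  linear_combination e

end Deletion

/-! ### Flats and ranks of minors -/

section Matroid

variable {α : Type*}

theorem rk_closure (M : Matroid α) (A : Set α) : rk M (M.closure A) = rk M A := by
  rw [rk, rk, M.eRk_closure_eq]

theorem rk_insert (M : Matroid α) [M.Finite] {A : Set α} {i : α} (hi : i ∈ M.E)
    (hA : i ∉ M.closure A) : rk M (A ∪ {i}) = rk M A + 1 := by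
  rw [rk, rk, Set.union_singleton, Matroid.eRk_insert_eq_add_one ⟨hi, hA⟩,
    ENat.toNat_add (M.isRkFinite_set A).eRk_lt_top.ne (by simp)]
  rfl

theorem rk_restrict (M : Matroid α) {A R : Set α} (h : A ⊆ R) : rk (M ↾ R) A = rk M A := by
  rw [rk, rk, M.restrict_eRk_eq h]

theorem rk_delete (M : Matroid α) {A D : Set α} (hA : A ⊆ (M ＼ D).E) :
    rk (M ＼ D) A = rk M A :=
  rk_restrict M hA

theorem rk_contract (M : Matroid α) [M.Finite] {A C : Set α} (h : Disjoint A C) :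
    rk (M ／ C) A + rk M C = rk M (A ∪ C) := by
  obtain ⟨I, hI⟩ := M.exists_isBasis' C
  obtain ⟨J, hJ, hIJ⟩ := hI.indep.subset_isBasis'_of_subset
    (hI.subset.trans (Set.subset_union_right (s := A)))
  have hb : (M ／ C).IsBasis' (J \ C) ((A ∪ C) \ C) :=
    hJ.contract_isBasis' hI (hJ.indep.subset (Set.union_subset Set.sdiff_subset hIJ))
  have hJC : J ∩ C = I := by
    refine (hI.eq_of_subset_indep (hJ.indep.subset Set.inter_subset_left) ?_
      Set.inter_subset_right).symm
    exact Set.subset_inter hIJ hI.subset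
  rw [Set.union_sdiff_right, h.sdiff_eq_left] at hb
  have hfin : J.encard ≠ ⊤ := by
    rw [hJ.encard_eq_eRk]
    exact (M.isRkFinite_set _).eRk_lt_top.ne
  rw [rk, rk, rk, ← hb.encard_eq_eRk, ← hI.encard_eq_eRk, ← hJ.encard_eq_eRk,
    ← Set.encard_sdiff_add_encard_inter J C, hJC, ENat.toNat_add]
  · exact ne_top_of_le_ne_top hfin (Set.encard_le_encard Set.sdiff_subset)
  · exact ne_top_of_le_ne_top hfin (Set.encard_le_encard hIJ)

theorem isFlat_restrict_iff (M : Matroid α) {F K : Set α} (hF : M.IsFlat F) :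
    (M ↾ F).IsFlat K ↔ M.IsFlat K ∧ K ⊆ F := by
  constructor
  · intro h
    have hK : K ⊆ F := h.subset_ground
    have e := h.closure
    rw [M.restrict_closure_eq hK hF.subset_ground, Set.inter_eq_left.2
      ((M.closure_subset_closure hK).trans hF.closure.le)] at e
    exact ⟨Matroid.isFlat_iff_closure_eq.2 e, hK⟩
  · rintro ⟨h, hK⟩
    rw [Matroid.isFlat_iff_closure_eq, M.restrict_closure_eq hK hF.subset_ground, h.closure,
      Set.inter_eq_left.2 hK]

theorem isFlat_contract_iff (M : Matroid α) {C K : Set α} (hC : C ⊆ M.E) :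
    (M ／ C).IsFlat K ↔ M.IsFlat (K ∪ C) ∧ Disjoint K C := by
  constructor
  · intro h
    have hd : Disjoint K C := Set.disjoint_of_subset_left h.subset_ground Set.disjoint_sdiff_left
    refine ⟨?_, hd⟩
    have e := h.closure
    rw [M.contract_closure_eq] at e
    have hsub : K ∪ C ⊆ M.E := Set.union_subset (h.subset_ground.trans Set.sdiff_subset) hC
    rw [Matroid.isFlat_iff_closure_eq]
    conv_rhs => rw [← e]
    rw [Set.sdiff_union_of_subset]
    exact Set.subset_union_right.trans (M.subset_closure _ hsub)
  · rintro ⟨h, hd⟩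
    rw [Matroid.isFlat_iff_closure_eq, M.contract_closure_eq, h.closure, Set.union_sdiff_right,
      hd.sdiff_eq_left]

/-- The identification of `L(M ↾ F)` with the interval of `L(M)` below a flat `F`. -/
def restrictEmb (M : Matroid α) (F : Flat M) : Flat (M ↾ F.1) ↪o Flat M where
  toFun K := ⟨K.1, ((isFlat_restrict_iff M F.2).1 K.2).1⟩
  inj' _ _ h := Subtype.ext (congrArg (fun K : Flat M => K.1) h)
  map_rel_iff' := Iff.rfl

theorem isConvexEmbedding_restrictEmb (M : Matroid α) [M.Finite] (F : Flat M) :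
    IsConvexEmbedding (flatRank (M ↾ F.1)) (flatRank M) (restrictEmb M F) where
  rank_eq s t _ := by
    change rk M t.1 - rk M s.1 = rk (M ↾ F.1) t.1 - rk (M ↾ F.1) s.1
    rw [rk_restrict M (show t.1 ⊆ F.1 from t.2.subset_ground),
      rk_restrict M (show s.1 ⊆ F.1 from s.2.subset_ground)]
  convex s t w _ h :=
    ⟨⟨w.1, (isFlat_restrict_iff M F.2).2 ⟨w.2, Set.Subset.trans h t.2.subset_ground⟩⟩, rfl⟩

/-- The identification of `L(M ／ C)` with the interval of `L(M)` above the closure of `C`. -/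
def contractEmb (M : Matroid α) {C : Set α} (hC : C ⊆ M.E) : Flat (M ／ C) ↪o Flat M :=
  OrderEmbedding.ofMapLEIff
    (fun K => ⟨K.1 ∪ C, ((isFlat_contract_iff M hC).1 K.2).1⟩) fun K G => by
    have hK := ((isFlat_contract_iff M hC).1 K.2).2
    change K.1 ∪ C ⊆ G.1 ∪ C ↔ K.1 ⊆ G.1
    refine ⟨fun h x hx => ?_, fun h => Set.union_subset_union_left C h⟩
    exact (h (Or.inl hx)).resolve_right (Set.disjoint_left.1 hK hx)

theorem isConvexEmbedding_contractEmb (M : Matroid α) [M.Finite] {C : Set α} (hC : C ⊆ M.E) :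
    IsConvexEmbedding (flatRank (M ／ C)) (flatRank M) (contractEmb M hC) where
  rank_eq s t _ := by
    have hs := rk_contract M ((isFlat_contract_iff M hC).1 s.2).2
    have ht := rk_contract M ((isFlat_contract_iff M hC).1 t.2).2
    change rk M (t.1 ∪ C) - rk M (s.1 ∪ C) = rk (M ／ C) t.1 - rk (M ／ C) s.1
    omega
  convex s t w h _ := by
    have hCw : C ⊆ w.1 := Set.Subset.trans Set.subset_union_right h
    have e : w.1 \ C ∪ C = w.1 := Set.sdiff_union_of_subset hCw
    refine ⟨⟨w.1 \ C, (isFlat_contract_iff M hC).2 ⟨?_, Set.disjoint_sdiff_left⟩⟩, Subtype.ext e⟩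
    rw [e]
    exact w.2

theorem dualChowPoly_restrict (M : Matroid α) [M.Finite] (F : Flat M) :
    dualChowPoly (M ↾ F.1) = dualChow (flatRank M) (charKernel (flatRank M)) ⊥ F := by
  have h := congrArg (fun a => a ⊥ ⊤) (isConvexEmbedding_restrictEmb M F).pullback_dualChow
  rw [dualChowPoly]
  refine h.symm.trans ?_
  have hbot : restrictEmb M F ⊥ = ⊥ := by
    refine Subtype.ext ?_
    change (M ↾ F.1).closure ∅ = M.closure ∅
    rw [M.restrict_closure_eq (Set.empty_subset _) F.2.subset_ground, Set.inter_eq_left]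
    exact (M.closure_subset_closure (Set.empty_subset _)).trans F.2.closure.le
  rw [pullback_apply, hbot]
  rfl

theorem contractEmb_bot (M : Matroid α) {C : Set α} (hC : C ⊆ M.E) :
    contractEmb M hC ⊥ = ⟨M.closure C, M.isFlat_closure C⟩ := by
  refine Subtype.ext ?_
  change (M ／ C).closure ∅ ∪ C = M.closure C
  rw [M.contract_closure_eq, Set.empty_union, Set.sdiff_union_of_subset (M.subset_closure C hC)]

theorem contractEmb_top (M : Matroid α) {C : Set α} (hC : C ⊆ M.E) :
    contractEmb M hC ⊤ = ⊤ :=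
  Subtype.ext (Set.sdiff_union_of_subset hC)

theorem dualChowPoly_contract (M : Matroid α) [M.Finite] {C : Set α} (hC : C ⊆ M.E) :
    dualChowPoly (M ／ C) = dualChow (flatRank M) (charKernel (flatRank M))
      ⟨M.closure C, M.isFlat_closure C⟩ ⊤ := by
  have h := congrArg (fun a => a ⊥ ⊤) (isConvexEmbedding_contractEmb M hC).pullback_dualChow
  rw [dualChowPoly]
  refine h.symm.trans ?_
  rw [pullback_apply, contractEmb_bot, contractEmb_top]

theorem dualRightAugChowPoly_contract (M : Matroid α) [M.Finite] {C : Set α} (hC : C ⊆ M.E) :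
    dualRightAugChowPoly (M ／ C) = dualRightAugChow (flatRank M) (charKernel (flatRank M))
      ⟨M.closure C, M.isFlat_closure C⟩ ⊤ := by
  have h := congrArg (fun a => a ⊥ ⊤) (isConvexEmbedding_contractEmb M hC).pullback_dualRightAugChow
  rw [dualRightAugChowPoly]
  refine h.symm.trans ?_
  rw [pullback_apply, contractEmb_bot, contractEmb_top]

/-! ### Deletion of a single element -/

/-- Here `K` is not assumed to avoid `i`; both sides imply that it does. -/
theorem isFlat_delete_iff {M : Matroid α} {i : α} {K : Set α} :
    (M ＼ {i}).IsFlat K ↔ M.closure K \ {i} = K := by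
  rw [Matroid.isFlat_iff_closure_eq]
  constructor
  · intro h
    have hK : i ∉ K := by
      rw [← h]
      exact fun hi => ((M ＼ {i}).closure_subset_ground K hi).2 rfl
    rwa [M.delete_closure_eq, Set.sdiff_singleton_eq_self hK] at h
  · intro h
    have hK : i ∉ K := by
      rw [← h]
      exact fun hi => hi.2 rfl
    rwa [M.delete_closure_eq, Set.sdiff_singleton_eq_self hK]

theorem notMem_of_isFlat_delete {M : Matroid α} {i : α} {K : Set α} (h : (M ＼ {i}).IsFlat K) :
    i ∉ K := fun hi => (h.subset_ground hi).2 rfl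

/-- A flat avoiding `i` is a flat of the deletion of `i`. -/
theorem isFlat_delete_of_notMem {M : Matroid α} {i : α} {K : Set α} (h : M.IsFlat K)
    (hi : i ∉ K) : (M ＼ {i}).IsFlat K := by
  rw [isFlat_delete_iff, h.closure, Set.sdiff_singleton_eq_self hi]

theorem mem_flatsExtendableBy {M : Matroid α} [M.Finite] {i : α} {F : Flat M} :
    F ∈ flatsExtendableBy M i ↔ i ∉ F.1 ∧ M.IsFlat (F.1 ∪ {i}) := by
  simp [flatsExtendableBy]

/-- The closure map from the flats of a deletion to the flats of the matroid. -/
def closureOfDelete (M : Matroid α) (i : α) (K : Flat (M ＼ {i})) : Flat M :=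
  ⟨M.closure K.1, M.isFlat_closure K.1⟩

/-- An extendable flat, as a flat of the deletion. -/
def extendableToDelete (M : Matroid α) [M.Finite] (i : α)
    (F : {F // F ∈ flatsExtendableBy M i}) : Flat (M ＼ {i}) :=
  ⟨F.1.1, isFlat_delete_of_notMem F.1.2 (mem_flatsExtendableBy.1 F.2).1⟩

/-- The flat obtained from an extendable flat by adding `i`. -/
def extendFlat (M : Matroid α) [M.Finite] (i : α) (F : {F // F ∈ flatsExtendableBy M i}) :
    Flat M :=
  ⟨F.1.1 ∪ {i}, (mem_flatsExtendableBy.1 F.2).2⟩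

theorem closureOfDelete_le_iff (M : Matroid α) (i : α) (K G : Flat (M ＼ {i})) :
    closureOfDelete M i K ≤ closureOfDelete M i G ↔ K ≤ G := by
  refine ⟨fun h => ?_, fun h => M.closure_subset_closure h⟩
  change K.1 ⊆ G.1
  rw [← isFlat_delete_iff.1 K.2, ← isFlat_delete_iff.1 G.2]
  exact Set.sdiff_subset_sdiff_left h

theorem closureOfDelete_le_extendFlat_iff (M : Matroid α) [M.Finite] (i : α)
    (K : Flat (M ＼ {i})) (F : {F // F ∈ flatsExtendableBy M i}) :
    closureOfDelete M i K ≤ extendFlat M i F ↔ K ≤ extendableToDelete M i F := by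
  have hi := notMem_of_isFlat_delete K.2
  constructor
  · intro h x hx
    have hxE : K.1 ⊆ M.E := K.2.subset_ground.trans Set.sdiff_subset
    refine (h (M.subset_closure K.1 hxE hx)).resolve_right ?_
    rintro rfl
    exact hi hx
  · intro h
    have h' : K.1 ⊆ F.1.1 := h
    exact ((M.closure_subset_closure h').trans F.1.2.closure.le).trans Set.subset_union_left

/-- A flat `G` of `M` not containing `i` is the closure of the flat `G` of the deletion; a flat
`G` containing `i` is the closure of `G \ {i}` if `i` lies in that closure, and otherwise it is
`F ∪ {i}` for the extendable flat `F = G \ {i}`. -/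
theorem isDeletion_flat (M : Matroid α) [M.Finite] {i : α} (hi : i ∈ M.E) :
    IsDeletion (flatRank M) (flatRank (M ＼ {i})) (closureOfDelete M i)
      (extendableToDelete M i) (extendFlat M i) where
  bijective := by
    constructor
    · have hστ : ∀ K F, closureOfDelete M i K ≠ extendFlat M i F := by
        intro K F e
        have e' : M.closure K.1 = F.1.1 ∪ {i} := congrArg Subtype.val e
        have hF := (mem_flatsExtendableBy.1 F.2).1
        have hK := isFlat_delete_iff.1 K.2
        rw [e', Set.union_sdiff_right, Set.sdiff_singleton_eq_self hF] at hK
        rw [← hK, F.1.2.closure] at e'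
        exact hF (e'.symm ▸ Or.inr rfl)
      rintro (K | F) (K' | F') e
      · refine congrArg Sum.inl (le_antisymm ?_ ?_)
        · exact (closureOfDelete_le_iff M i K K').1 (le_of_eq e)
        · exact (closureOfDelete_le_iff M i K' K).1 (ge_of_eq e)
      · exact absurd e (hστ K F')
      · exact absurd e.symm (hστ K' F)
      · have e' : F.1.1 ∪ {i} = F'.1.1 ∪ {i} := congrArg Subtype.val e
        have h := congrArg (· \ {i}) e'
        simp only [Set.union_sdiff_right, Set.sdiff_singleton_eq_self
          (mem_flatsExtendableBy.1 F.2).1, Set.sdiff_singleton_eq_self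
          (mem_flatsExtendableBy.1 F'.2).1] at h
        exact congrArg Sum.inr (Subtype.ext (Subtype.ext h))
    · intro G
      by_cases hG : i ∈ G.1
      · have hu : G.1 \ {i} ∪ {i} = G.1 :=
          Set.sdiff_union_of_subset (Set.singleton_subset_iff.2 hG)
        have hsub : M.closure (G.1 \ {i}) ⊆ G.1 :=
          (M.closure_subset_closure Set.sdiff_subset).trans G.2.closure.le
        have hsub' : G.1 \ {i} ⊆ M.closure (G.1 \ {i}) :=
          M.subset_closure _ (Set.sdiff_subset.trans G.2.subset_ground)
        by_cases hc : i ∈ M.closure (G.1 \ {i})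
        · have hcl : M.closure (G.1 \ {i}) = G.1 := by
            refine hsub.antisymm ?_
            rw [← hu]
            exact Set.union_subset (by rwa [hu]) (Set.singleton_subset_iff.2 (by rwa [hu]))
          exact ⟨Sum.inl ⟨G.1 \ {i}, isFlat_delete_iff.2 (by rw [hcl])⟩, Subtype.ext hcl⟩
        · have hcl : M.closure (G.1 \ {i}) = G.1 \ {i} :=
            (Set.subset_sdiff_singleton hsub hc).antisymm hsub'
          refine ⟨Sum.inr ⟨⟨G.1 \ {i}, Matroid.isFlat_iff_closure_eq.2 hcl⟩,
            mem_flatsExtendableBy.2 ⟨fun h => h.2 rfl, ?_⟩⟩, Subtype.ext hu⟩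
          change M.IsFlat (G.1 \ {i} ∪ {i})
          rw [hu]
          exact G.2
      · exact ⟨Sum.inl ⟨G.1, isFlat_delete_of_notMem G.2 hG⟩, Subtype.ext G.2.closure⟩
  le_iff := closureOfDelete_le_iff M i
  rank_eq K G _ := by
    change rk M (M.closure G.1) - rk M (M.closure K.1) = rk (M ＼ {i}) G.1 - rk (M ＼ {i}) K.1
    rw [rk_closure, rk_closure, rk_delete M G.2.subset_ground, rk_delete M K.2.subset_ground]
  le_iff' := closureOfDelete_le_extendFlat_iff M i
  rank_eq' K F h := by
    have hF := (mem_flatsExtendableBy.1 F.2).1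
    have hFd : F.1.1 ⊆ (M ＼ {i}).E := (extendableToDelete M i F).2.subset_ground
    have h' := rk_mono M (show K.1 ⊆ F.1.1 from h)
    change rk M (F.1.1 ∪ {i}) - rk M (M.closure K.1) = rk (M ＼ {i}) F.1.1 - rk (M ＼ {i}) K.1 + 1
    rw [rk_closure, rk_delete M hFd, rk_delete M K.2.subset_ground,
      rk_insert M hi (by rwa [F.1.2.closure])]
    omega

theorem closureOfDelete_bot (M : Matroid α) {i : α} (hi : M.IsNonloop i) :
    closureOfDelete M i ⊥ = ⊥ := by
  refine Subtype.ext ?_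
  change M.closure ((M ＼ {i}).closure ∅) = M.closure ∅
  have h : i ∉ M.closure ∅ := hi.not_isLoop
  rw [M.delete_closure_eq, Set.empty_sdiff, Set.sdiff_singleton_eq_self h, M.closure_closure]

/-- This is where it matters that `i` is not a coloop: otherwise the top flat of `M` would be an
extension `F ∪ {i}` rather than a closure. -/
theorem closureOfDelete_top (M : Matroid α) {i : α} (hi : ¬ M.IsColoop i) :
    closureOfDelete M i ⊤ = ⊤ := by
  refine Subtype.ext ?_
  rw [Matroid.isColoop_iff_sdiff_closure, not_not] at hi
  exact hi

/-- If `i` is a nonloop that is not parallel to another element, then adding it to the set of loops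
yields a flat. -/
theorem bot_mem_flatsExtendableBy (M : Matroid α) [M.Finite] {i : α} (hloop : M.IsNonloop i)
    (hparallel : ∀ j, ¬ Parallel M i j) : (⊥ : Flat M) ∈ flatsExtendableBy M i := by
  have h : i ∉ M.closure ∅ := hloop.not_isLoop
  rw [mem_flatsExtendableBy]
  refine ⟨h, ?_⟩
  change M.IsFlat (M.closure ∅ ∪ {i})
  have hsub : M.closure ∅ ∪ {i} ⊆ M.closure {i} :=
    Set.union_subset (M.closure_subset_closure (Set.empty_subset _))
      (Set.singleton_subset_iff.2 (M.mem_closure_self i hloop.mem_ground))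
  have e : M.closure ∅ ∪ {i} = M.closure {i} := by
    refine hsub.antisymm fun j hj => ?_
    by_contra hne
    rw [Set.mem_union, not_or] at hne
    have hji : i ≠ j := fun e => hne.2 e.symm
    have hjn : M.IsNonloop j :=
      (Matroid.not_isLoop_iff (M.mem_ground_of_mem_closure hj)).1 hne.1
    exact hparallel j ⟨hji, (hloop.closure_eq_closure_iff_isCircuit_of_ne hji).1
      (hjn.closure_eq_of_mem_closure hj).symm⟩
  rw [e]
  exact M.isFlat_closure _

theorem dualChowPoly_restrict_extendable (M : Matroid α) [M.Finite] (i : α)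
    (F : {F // F ∈ flatsExtendableBy M i}) :
    dualChow (flatRank (M ＼ {i})) (charKernel (flatRank (M ＼ {i}))) ⊥
      (extendableToDelete M i F) = dualChowPoly (M ↾ F.1.1) := by
  rw [← dualChowPoly_restrict]
  have h : (M ＼ {i}) ↾ F.1.1 = M ↾ F.1.1 :=
    Matroid.restrict_restrict_eq M (extendableToDelete M i F).2.subset_ground
  have key : ∀ (N : Matroid α) [N.Finite], N = M ↾ F.1.1 →
      dualChowPoly N = dualChowPoly (M ↾ F.1.1) := by
    rintro N _ rfl
    rfl
  exact key _ h

theorem extendFlat_eq_closure (M : Matroid α) [M.Finite] (i : α)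
    (F : {F // F ∈ flatsExtendableBy M i}) :
    extendFlat M i F = ⟨M.closure (F.1.1 ∪ {i}), M.isFlat_closure _⟩ :=
  Subtype.ext (mem_flatsExtendableBy.1 F.2).2.closure.symm

/-- The `⊥`-entry of the extension by zero is the value at the contraction of `i`. -/
theorem extensionMap_bot (M : Matroid α) [M.Finite] {i : α}
    (hbot : (⊥ : Flat M) ∈ flatsExtendableBy M i) (h : Flat M → ℤ[X]) :
    extensionMap (extendableToDelete M i) (extendFlat M i) h ⊥ =
      h (extendFlat M i ⟨⊥, hbot⟩) := by
  have hl : i ∉ M.closure ∅ := (mem_flatsExtendableBy.1 hbot).1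
  have hb : ((⊥ : Flat (M ＼ {i})) : Set α) = M.closure ∅ := by
    change (M ＼ {i}).closure ∅ = _
    rw [M.delete_closure_eq, Set.empty_sdiff, Set.sdiff_singleton_eq_self hl]
  rw [extensionMap, Fintype.sum_eq_single ⟨⊥, hbot⟩, if_pos]
  · exact Subtype.ext hb.symm
  · intro F hF
    refine if_neg fun e => hF (Subtype.ext (Subtype.ext ?_))
    exact (congrArg Subtype.val e).trans hb

theorem extendFlat_bot (M : Matroid α) [M.Finite] {i : α}
    (hbot : (⊥ : Flat M) ∈ flatsExtendableBy M i) :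
    extendFlat M i ⟨⊥, hbot⟩ = ⟨M.closure {i}, M.isFlat_closure _⟩ := by
  rw [extendFlat_eq_closure]
  refine Subtype.ext ?_
  change M.closure (M.closure ∅ ∪ {i}) = M.closure {i}
  rw [M.closure_union_closure_left_eq, Set.empty_union]

theorem dualChowPoly_restrict_bot (M : Matroid α) [M.Finite] :
    dualChowPoly (M ↾ (⊥ : Flat M).1) = 1 := by
  rw [dualChowPoly_restrict]
  exact chow_self (flatRank M) _ _

end Matroid

end DualChow

open DualChow in
theorem theorem6 {α : Type*} (M : Matroid α) [M.Finite] (i : α)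
    (hloop : M.IsNonloop i) (hcoloop : ¬ M.IsColoop i)
    (hparallel : ∀ j, ¬ DualChow.Parallel M i j) :
    (DualChow.dualChowPoly M =
      DualChow.dualChowPoly (M ＼ {i})
        + (X + 1) * DualChow.dualChowPoly (M ／ {i})
        + X * ∑ F ∈ (DualChow.flatsExtendableBy M i).erase ⊥,
            DualChow.dualChowPoly (M ↾ F.1)
              * DualChow.dualChowPoly (M ／ (F.1 ∪ {i}))) ∧
    (DualChow.dualRightAugChowPoly M =
      DualChow.dualRightAugChowPoly (M ＼ {i})
        + (X + 1) * DualChow.dualRightAugChowPoly (M ／ {i})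
        + X * ∑ F ∈ (DualChow.flatsExtendableBy M i).erase ⊥,
            DualChow.dualChowPoly (M ↾ F.1)
              * DualChow.dualRightAugChowPoly (M ／ (F.1 ∪ {i}))) := by
  have hi := hloop.mem_ground
  have hiE : {i} ⊆ M.E := Set.singleton_subset_iff.2 hi
  have hbot := bot_mem_flatsExtendableBy M hloop hparallel
  have hFi : ∀ F : Flat M, F.1 ∪ {i} ⊆ M.E := fun F => Set.union_subset F.2.subset_ground hiE
  have D := isDeletion_flat M hi
  have hbi : (⟨M.closure ((⊥ : Flat M).1 ∪ {i}), M.isFlat_closure _⟩ : Flat M) =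
      ⟨M.closure {i}, M.isFlat_closure _⟩ := by
    rw [← extendFlat_bot M hbot, extendFlat_eq_closure]
  constructor
  · have h := D.dualChow_apply ⊥ ⊤
    rw [closureOfDelete_bot M hloop, closureOfDelete_top M hcoloop, extensionMap_bot M hbot,
      extendFlat_bot M, ← dualChowPoly_contract M hiE] at h
    simp only [dualChowPoly_restrict_extendable, extendFlat_eq_closure,
      ← dualChowPoly_contract M (hFi _)] at h
    rw [Finset.sum_coe_sort (flatsExtendableBy M i) fun F =>
      dualChowPoly (M ↾ F.1) * dualChowPoly (M ／ (F.1 ∪ {i})), ← Finset.add_sum_erase _ _ hbot,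
      dualChowPoly_restrict_bot, dualChowPoly_contract M (hFi ⊥), hbi,
      ← dualChowPoly_contract M hiE] at h
    change dualChowPoly M = dualChowPoly (M ＼ {i}) + _ + _ at h
    linear_combination h
  · have h := D.dualRightAugChow_apply ⊥ ⊤
    rw [closureOfDelete_bot M hloop, closureOfDelete_top M hcoloop, extensionMap_bot M hbot,
      extendFlat_bot M, ← dualRightAugChowPoly_contract M hiE] at h
    simp only [dualChowPoly_restrict_extendable, extendFlat_eq_closure,
      ← dualRightAugChowPoly_contract M (hFi _)] at h
    rw [Finset.sum_coe_sort (flatsExtendableBy M i) fun F =>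
      dualChowPoly (M ↾ F.1) * dualRightAugChowPoly (M ／ (F.1 ∪ {i})),
      ← Finset.add_sum_erase _ _ hbot,
      dualChowPoly_restrict_bot, dualRightAugChowPoly_contract M (hFi ⊥), hbi,
      ← dualRightAugChowPoly_contract M hiE] at h
    change dualRightAugChowPoly M = dualRightAugChowPoly (M ＼ {i}) + _ + _ at h
    linear_combination h
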